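/- **Setting.** Let $n,m,d,K$ be natural numbers with $1\le K<n$ and $m\ge 1$. A dataset is an $n$-tuple $X=(x_1,\dots,x_n)$ of records $x_i\in\mathbb R^d$, with the Euclidean norm. We write $X\sim\mathcal N(\mu,\Sigma)$ if the records of $X$ are independent with law $\mathcal N(\mu,\Sigma)$. *SMOTE.* Given a dataset $X$, a SMOTE sample is $z=x_i+w(x_j-x_i)$, where $i$ is uniform in $\{1,\dots,n\}$, $j$ is uniform among the $K$ nearest neighbours of $x_i$ in $\{x_k: k\ne i\}$ (equal distances are ordered by the index), and $w$ is uniform in $[0,1]$. The SMOTE-transformed dataset $X_S=f_S(X)$ consists of $m$ SMOTE samples that are independent given $X$. *Sensitivity.* For a random dataset $Y$ let $\mu_Y$ and $\Sigma_Y$ be the mean vector and the covariance matrix of a uniformly chosen record of $Y$. Let $\Theta$ be a set of pairs $(\mu,\Sigma)$ with $\mu\in\mathbb R^d$ and $\Sigma\neq 0$ a symmetric positive semidefinite $d\times d$ matrix; a single pair, $\Theta=\{(\mu,\Sigma)\}$, is the basic case. A pair of neighbouring datasets is a pair of random datasets $(X,X')$ of size $n$ on a common probability space such that $X\sim\mathcal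 N(\mu,\Sigma)$ and $X'\sim\mathcal N(\mu',\Sigma')$ with $(\mu,\Sigma),(\mu',\Sigma')\in\Theta$ and such that, almost surely, $X$ and $X'$ differ in at most one record. The sensitivity of a (possibly random) generative model $f$ is $$\Delta(f)=\max_{(X,X')}\Bigl(\|\mu_{f(X)}-\mu_{f(X')}\|+\operatorname{tr}\bigl(\Sigma_{f(X)}+\Sigma_{f(X')}\bigr)\Bigr),$$ the maximum being over all pairs of neighbouring datasets. Write $\Delta f$ for the sensitivity of the identity (the original data) and $\Delta f_s$ for the sensitivity of SMOTE, $f=f_S$. **Theorem (SMOTE sensitivity reduction).** Whenever the two maxima exist, $$\Delta f_s<\Delta f .$$ Both maxima exist if $\Theta$ is finite and non-empty, in particular if $\Theta=\{(\mu,\Sigma)\}$. -/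

import Mathlib

open MeasureTheory ProbabilityTheory
open scoped ENNReal

noncomputable section

namespace SmoteDP

/-- A record with `d` real attributes, with the Euclidean norm. -/
abbrev Record (d : ℕ) : Type := EuclideanSpace ℝ (Fin d)

/-- A dataset of `n` records. -/
abbrev Dataset (n d : ℕ) : Type := Fin n → Record d

/-- `Closer x i k j`: seen from the record `x i`, the record `x k` comes before the record `x j`
in the order of increasing distance (equal distances are ordered by the index). -/
def Closer {n d : ℕ} (x : Dataset n d) (i k j : Fin n) : Prop :=
  dist (x k) (x i) < dist (x j) (x i) ∨ (dist (x k) (x i) = dist (x j) (x i) ∧ k < j)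

open Classical in
/-- The (indices of the) `K` nearest neighbours of `x i` among the other records of `x`:
those `j ≠ i` that are preceded by fewer than `K` other records. -/
def nearest {n d : ℕ} (K : ℕ) (x : Dataset n d) (i : Fin n) : Finset (Fin n) :=
  {j | j ≠ i ∧ Finset.card {k | k ≠ i ∧ Closer x i k j} < K}

/-- The uniform distribution on the segment from `a` to `b`: the law of `a + w (b - a)` with `w`
uniform in `[0, 1]`. -/
def segmentLaw {d : ℕ} (a b : Record d) : Measure (Record d) :=
  (volume.restrict (Set.Icc (0 : ℝ) 1)).map fun w => a + w • (b - a)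

/-- The law of one SMOTE sample from the dataset `x`: choose a base record `x i` uniformly, then
one of its `K` nearest neighbours `x j` uniformly, and interpolate with a uniform weight. -/
def smoteSample {n d : ℕ} (K : ℕ) (x : Dataset n d) : Measure (Record d) :=
  (n : ℝ≥0∞)⁻¹ • ∑ i, ((nearest K x i).card : ℝ≥0∞)⁻¹ •
    ∑ j ∈ nearest K x i, segmentLaw (x i) (x j)

lemma segmentLaw_apply {d : ℕ} (a b : Record d) {s : Set (Record d)} (hs : MeasurableSet s) :
    segmentLaw a b s =
      volume.restrict (Set.Icc (0 : ℝ) 1) ((fun w : ℝ => a + w • (b - a)) ⁻¹' s) :=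
  Measure.map_apply (by fun_prop) hs

instance {d : ℕ} (a b : Record d) : IsProbabilityMeasure (segmentLaw a b) := by
  have : IsProbabilityMeasure (volume.restrict (Set.Icc (0 : ℝ) 1)) := ⟨by simp⟩
  exact Measure.isProbabilityMeasure_map (by fun_prop)

instance {n d : ℕ} (K : ℕ) (x : Dataset n d) : IsFiniteMeasure (smoteSample K x) := by
  refine ⟨lt_of_le_of_lt (b := 1) ?_ (by simp)⟩
  simp only [smoteSample, Measure.smul_apply, Measure.coe_finsetSum, Finset.sum_apply,
    measure_univ, smul_eq_mul, Finset.sum_const, nsmul_eq_mul, mul_one]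
  calc (n : ℝ≥0∞)⁻¹ * ∑ i, ((nearest K x i).card : ℝ≥0∞)⁻¹ * ((nearest K x i).card : ℝ≥0∞)
      ≤ (n : ℝ≥0∞)⁻¹ * ∑ _i : Fin n, 1 := by
        gcongr
        exact ENNReal.inv_mul_le_one _
    _ ≤ 1 := by simp [ENNReal.inv_mul_le_one]

lemma measurableSet_closer {n d : ℕ} (i k j : Fin n) :
    MeasurableSet {x : Dataset n d | Closer x i k j} := by
  have hd : ∀ k : Fin n, Measurable fun x : Dataset n d => dist (x k) (x i) := fun k => by
    fun_prop
  exact (measurableSet_lt (hd k) (hd j)).union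
    ((measurableSet_eq_fun (hd k) (hd j)).inter (MeasurableSet.const _))

lemma measurableSet_mem_nearest {n d : ℕ} (K : ℕ) (i j : Fin n) :
    MeasurableSet {x : Dataset n d | j ∈ nearest K x i} := by
  classical
  have h : Measurable fun x : Dataset n d =>
      ∑ k : Fin n, if k ≠ i ∧ Closer x i k j then 1 else 0 := by
    refine Finset.measurable_sum _ fun k _ => ?_
    exact Measurable.ite ((MeasurableSet.const _).inter (measurableSet_closer i k j))
      measurable_const measurable_const
  have h2 : {x : Dataset n d | j ∈ nearest K x i} =
      {_x | j ≠ i} ∩ {x | (∑ k : Fin n, if k ≠ i ∧ Closer x i k j then 1 else 0) < K} := by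
    ext x
    simp only [nearest, Finset.mem_filter, Finset.mem_univ, true_and, Set.mem_ofPred_eq,
      Set.mem_inter_iff, Finset.card_filter]
  rw [h2]
  exact (MeasurableSet.const _).inter (measurableSet_lt h measurable_const)

lemma measurable_smoteSample {n d : ℕ} (K : ℕ) :
    Measurable (smoteSample K : Dataset n d → Measure (Record d)) := by
  classical
  refine Measure.measurable_of_measurable_coe _ fun s hs => ?_
  have hseg : ∀ i j : Fin n, Measurable fun x : Dataset n d => segmentLaw (x i) (x j) s := by
    intro i j
    simp_rw [segmentLaw_apply _ _ hs]
    have hf : Measurable fun p : Dataset n d × ℝ => p.1 i + p.2 • (p.1 j - p.1 i) := by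
      fun_prop
    exact measurable_measure_prodMk_left (hf hs)
  have hcard : ∀ i : Fin n, Measurable fun x : Dataset n d =>
      ((nearest K x i).card : ℝ≥0∞)⁻¹ := by
    intro i
    have h : ∀ x : Dataset n d, ((nearest K x i).card : ℝ≥0∞) =
        ∑ j : Fin n, if j ∈ nearest K x i then 1 else 0 := by
      intro x; simp
    simp_rw [h]
    exact (Finset.measurable_sum _ fun j _ => Measurable.ite (measurableSet_mem_nearest K i j)
      measurable_const measurable_const).inv
  have hsum : ∀ i : Fin n, Measurable fun x : Dataset n d =>
      ∑ j ∈ nearest K x i, segmentLaw (x i) (x j) s := by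
    intro i
    have h : ∀ x : Dataset n d, ∑ j ∈ nearest K x i, segmentLaw (x i) (x j) s =
        ∑ j : Fin n, if j ∈ nearest K x i then segmentLaw (x i) (x j) s else 0 := by
      intro x; simp [Finset.sum_ite_mem]
    simp_rw [h]
    exact Finset.measurable_sum _ fun j _ => Measurable.ite (measurableSet_mem_nearest K i j)
      (hseg i j) measurable_const
  simp only [smoteSample, Measure.smul_apply, Measure.coe_finsetSum, Finset.sum_apply,
    smul_eq_mul]
  exact (Finset.measurable_sum _ fun i _ => (hcard i).mul (hsum i)).const_mul _

lemma measurable_pi_smoteSample {n d : ℕ} (K m : ℕ) :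
    Measurable fun x : Dataset n d => Measure.pi fun _ : Fin m => smoteSample K x := by
  have hrow : ∀ s : Set (Record d), MeasurableSet s →
      Measurable fun x : Dataset n d => smoteSample K x s := fun s hs =>
    (Measure.measurable_coe hs).comp (measurable_smoteSample K)
  refine Measurable.measure_of_isPiSystem generateFrom_pi.symm isPiSystem_pi ?_ ?_
  · rintro _ ⟨s, hs, rfl⟩
    simp_rw [Measure.pi_pi]
    exact Finset.measurable_prod _ fun r _ => hrow _ (hs r (Set.mem_univ _))
  · simp_rw [Measure.pi_univ]
    exact Finset.measurable_prod _ fun r _ => hrow _ MeasurableSet.univ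

/-- SMOTE with `K` neighbours as a generative model: it turns a dataset of `n` records into a
random dataset of `m` records, which are independent SMOTE samples from the given dataset. -/
def smote (n m d K : ℕ) : Kernel (Dataset n d) (Dataset m d) where
  toFun x := Measure.pi fun _ => smoteSample K x
  measurable' := measurable_pi_smoteSample K m

/-- The law of a uniformly chosen record of a random dataset with law `P`. -/
def recordLaw {m d : ℕ} (P : Measure (Dataset m d)) : Measure (Record d) :=
  (m : ℝ≥0∞)⁻¹ • ∑ r, P.map fun x => x r

/-- The mean vector of (a record of) a random dataset with law `P`. -/
def dataMean {m d : ℕ} (P : Measure (Dataset m d)) : Record d :=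
  ∫ z, z ∂(recordLaw P)

/-- The covariance matrix of (a record of) a random dataset with law `P`. -/
def dataCov {m d : ℕ} (P : Measure (Dataset m d)) : Matrix (Fin d) (Fin d) ℝ :=
  Matrix.of fun a b => cov[fun z => z a, fun z => z b; recordLaw P]

/-- The law of a dataset `X ∼ N(μ, Σ)` of `n` independent records; `θ = (μ, Σ)`. -/
def gaussianData (n : ℕ) {d : ℕ} (θ : Record d × Matrix (Fin d) (Fin d) ℝ) :
    Measure (Dataset n d) :=
  Measure.pi fun _ => multivariateGaussian θ.1 θ.2

open Classical in
/-- `π` is the joint law of two neighbouring Gaussian datasets `X ∼ N(θ)`, `X' ∼ N(θ')`: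
almost surely they differ in at most one record. -/
def IsNeighbouring {n d : ℕ} (θ θ' : Record d × Matrix (Fin d) (Fin d) ℝ)
    (π : Measure (Dataset n d × Dataset n d)) : Prop :=
  π.fst = gaussianData n θ ∧ π.snd = gaussianData n θ' ∧ ∀ᵐ p ∂π, hammingDist p.1 p.2 ≤ 1

/-- The numbers `‖μ_{f(X)} - μ_{f(X')}‖ + tr (Σ_{f(X)} + Σ_{f(X')})`, where `(X, X')` runs through
the pairs of neighbouring Gaussian datasets with parameters in `Θ` and `f` is a generative model.
The sensitivity of `f` is the maximum of this set. -/
def sensitivityValues {n m d : ℕ} (Θ : Set (Record d × Matrix (Fin d) (Fin d) ℝ))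
    (f : Kernel (Dataset n d) (Dataset m d)) : Set ℝ :=
  {v | ∃ θ ∈ Θ, ∃ θ' ∈ Θ, ∃ π : Measure (Dataset n d × Dataset n d), IsNeighbouring θ θ' π ∧
    v = ‖dataMean (π.fst.bind f) - dataMean (π.snd.bind f)‖ +
      (dataCov (π.fst.bind f) + dataCov (π.snd.bind f)).trace}

/-- `Δ` is the sensitivity of the generative model `f`. -/
def IsSensitivity {n m d : ℕ} (Θ : Set (Record d × Matrix (Fin d) (Fin d) ℝ))
    (f : Kernel (Dataset n d) (Dataset m d)) (Δ : ℝ) : Prop :=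
  IsGreatest (sensitivityValues Θ f) Δ

end SmoteDP

end

/-!
A SMOTE sample lies on the segment between a base record `a` and a neighbour `b`, at a uniform
position, so its second moment about the mean of the data is the average of those of `a` and `b`
minus `‖a - b‖² / 6`. Everything reduces to showing that the neighbour is on average no further
from the mean than the base record, whose law is the original Gaussian.

In principal axes the Gaussian has independent, symmetric unimodal coordinates. Exchanging the
`l`-th coordinates of `a` and `b` keeps their joint law and their distance; if it brings `b` closer
to the centre along the axis `l`, it takes `a` away, so that the ball around `a` through `b` loses
mass and `b` becomes more likely to be among the `K` nearest neighbours of `a`. A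
rearrangement inequality then compares the second moments of `a` and `b` axis by axis.

Two records of a nondegenerate Gaussian dataset almost surely differ, so the trace of the covariance
drops strictly, while the mean is kept because SMOTE commutes with the reflection in it.
-/

namespace SmoteDP

section ProductMeasures

lemma measurableSet_setOf_mem_mem {ι : Type*} [Finite ι] {X : ι → Type*}
    [∀ i, MeasurableSpace (X i)] {A : ∀ i, Set (X i)} (hA : ∀ i, MeasurableSet (A i))
    (𝒟 : Set (Set ι)) : MeasurableSet {x : ∀ i, X i | {i | x i ∈ A i} ∈ 𝒟} :=
  (measurable_set_iff.2 fun i => measurableSet_setOfPred.1 (measurable_pi_apply i (hA i)))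
    (Set.toFinite 𝒟).measurableSet

variable {ι : Type*} [Fintype ι] {X : ι → Type*} [∀ i, MeasurableSpace (X i)]
  (ν : ∀ i, Measure (X i))

lemma lintegral_pi_update [DecidableEq ι] [∀ i, IsProbabilityMeasure (ν i)] (i : ι)
    {f : (∀ i, X i) → ℝ≥0∞} (hf : Measurable f) :
    ∫⁻ t, ∫⁻ x, f (Function.update x i t) ∂Measure.pi ν ∂ν i = ∫⁻ x, f x ∂Measure.pi ν := by
  have hswap : ∫⁻ t, ∫⁻ x, f (Function.update x i t) ∂Measure.pi ν ∂ν i =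
      ∫⁻ x, ∫⁻ t, f (Function.update x i t) ∂ν i ∂Measure.pi ν :=
    lintegral_lintegral_swap (hf.comp (measurable_update'.comp measurable_swap)).aemeasurable
  have h : (fun x => ∫⁻ t, f (Function.update x i t) ∂ν i) = ∫⋯∫⁻_{i}, f ∂ν :=
    (lmarginal_singleton f i).symm
  refine hswap.trans (lintegral_eq_of_lmarginal_eq {i} (h ▸ hf.lmarginal ν) hf ?_)
  simp [lmarginal_singleton]

variable {ν}

lemma measure_pi_le_of_section_le [DecidableEq ι] [∀ i, SigmaFinite (ν i)] (i : ι)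
    {s t : Set (∀ i, X i)} (hs : MeasurableSet s) (ht : MeasurableSet t)
    (h : ∀ x, ν i {u | Function.update x i u ∈ s} ≤ ν i {u | Function.update x i u ∈ t}) :
    Measure.pi ν s ≤ Measure.pi ν t := by
  rw [← lintegral_indicator_one hs, ← lintegral_indicator_one ht]
  refine lintegral_le_of_lmarginal_le {i} (measurable_one.indicator hs)
    (measurable_one.indicator ht) fun x => ?_
  simp only [lmarginal_singleton]
  calc ∫⁻ u, s.indicator 1 (Function.update x i u) ∂ν i
      = ν i {u | Function.update x i u ∈ s} :=
        lintegral_indicator_one (measurable_update x hs)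
    _ ≤ ν i {u | Function.update x i u ∈ t} := h x
    _ = ∫⁻ u, t.indicator 1 (Function.update x i u) ∂ν i :=
        (lintegral_indicator_one (measurable_update x ht)).symm

lemma measure_pi_mem_update_le [DecidableEq ι] [∀ i, IsProbabilityMeasure (ν i)]
    {A : ∀ i, Set (X i)} (hA : ∀ i, MeasurableSet (A i)) (i : ι) {B : Set (X i)}
    (hB : MeasurableSet B) (hAB : ν i (A i) ≤ ν i B) {𝒟 : Set (Set ι)} (h𝒟 : IsLowerSet 𝒟) :
    Measure.pi ν {x | {k | x k ∈ Function.update A i B k} ∈ 𝒟} ≤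
      Measure.pi ν {x | {k | x k ∈ A k} ∈ 𝒟} := by
  have hB' : ∀ k, MeasurableSet (Function.update A i B k) :=
    (Function.forall_update_iff A fun _ s => MeasurableSet s).2 ⟨hB, fun k _ => hA k⟩
  refine measure_pi_le_of_section_le i (measurableSet_setOf_mem_mem hB' 𝒟)
    (measurableSet_setOf_mem_mem hA 𝒟) fun x => ?_
  set U : Set ι := {k | k ≠ i ∧ x k ∈ A k}
  have hpattern (C : Set (X i)) (u : X i) [Decidable (u ∈ C)] :
      {k | Function.update x i u k ∈ Function.update A i C k} =
        if u ∈ C then insert i U else U := by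
    ext k
    rcases eq_or_ne k i with rfl | hk <;> split_ifs <;> simp [U, *]
  classical
  have hA' (u : X i) : {k | Function.update x i u k ∈ A k} = if u ∈ A i then insert i U else U := by
    simpa using hpattern (A i) u
  simp only [Set.mem_ofPred_eq, hpattern, hA']
  by_cases hi : insert i U ∈ 𝒟
  · have hU : U ∈ 𝒟 := h𝒟 (Set.subset_insert i U) hi
    simp [apply_ite (· ∈ 𝒟), hi, hU]
  · by_cases hU : U ∈ 𝒟
    · have hcompl : ν i Bᶜ ≤ ν i (A i)ᶜ := by
        rw [prob_compl_eq_one_sub hB, prob_compl_eq_one_sub (hA i)]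
        exact tsub_le_tsub_left hAB 1
      simpa [apply_ite (· ∈ 𝒟), hi, hU, Set.compl_def] using hcompl
    · simp [apply_ite (· ∈ 𝒟), hi, hU]

lemma measure_pi_mem_le_of_isLowerSet [∀ i, IsProbabilityMeasure (ν i)]
    {A B : ∀ i, Set (X i)} (hA : ∀ i, MeasurableSet (A i)) (hB : ∀ i, MeasurableSet (B i))
    (hAB : ∀ i, ν i (A i) ≤ ν i (B i)) {𝒟 : Set (Set ι)} (h𝒟 : IsLowerSet 𝒟) :
    Measure.pi ν {x | {k | x k ∈ B k} ∈ 𝒟} ≤ Measure.pi ν {x | {k | x k ∈ A k} ∈ 𝒟} := by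
  classical
  suffices h : ∀ s : Finset ι, Measure.pi ν {x | {k | x k ∈ s.piecewise B A k} ∈ 𝒟} ≤
      Measure.pi ν {x | {k | x k ∈ A k} ∈ 𝒟} by simpa using h Finset.univ
  intro s
  induction s using Finset.induction_on with
  | empty => simp
  | insert i s hi ih =>
    rw [Finset.piecewise_insert]
    refine (measure_pi_mem_update_le (fun k => ?_) i (hB i) ?_ h𝒟).trans ih
    · by_cases hk : k ∈ s <;> simp [hk, hA, hB]
    · simpa [hi] using hAB i

lemma measure_pi_eval_eq_eval {Y : Type*} [MeasurableSpace Y] [MeasurableEq Y]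
    (ν : ι → Measure Y) [∀ i, SigmaFinite (ν i)] {i j : ι} (hij : i ≠ j)
    [NullSingletonClass (ν i)] : Measure.pi ν {x | x i = x j} = 0 := by
  have hm : MeasurableSet {x : ι → Y | x i = x j} :=
    measurableSet_eq_fun (measurable_pi_apply i) (measurable_pi_apply j)
  classical
  rw [← nonpos_iff_eq_zero, ← measure_empty (μ := Measure.pi ν)]
  refine measure_pi_le_of_section_le i hm .empty fun x => ?_
  simp [hij.symm]

end ProductMeasures

section Rearrangement

/-- The exchange of the `l`-th coordinates of two points of a product space: the symmetry under
which a base record is compared with its neighbour, one axis at a time. -/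
def swapCoord {κ Y : Type*} [DecidableEq κ] (l : κ) (p : (κ → Y) × (κ → Y)) :
    (κ → Y) × (κ → Y) :=
  (Function.update p.1 l (p.2 l), Function.update p.2 l (p.1 l))

lemma involutive_swapCoord {κ Y : Type*} [DecidableEq κ] (l : κ) :
    Function.Involutive (swapCoord l : (κ → Y) × (κ → Y) → _) := fun p => by
  simp [swapCoord]

lemma measurePreserving_swapCoord {κ Y : Type*} [Fintype κ] [DecidableEq κ] [MeasurableSpace Y]
    (γ : κ → Measure Y) [∀ k, SigmaFinite (γ k)] (l : κ) :
    MeasurePreserving (swapCoord l) ((Measure.pi γ).prod (Measure.pi γ))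
      ((Measure.pi γ).prod (Measure.pi γ)) := by
  have hpair := measurePreserving_arrowProdEquivProdArrow Y Y κ γ γ
  have hswap (k : κ) : MeasurePreserving (if k = l then Prod.swap else id)
      ((γ k).prod (γ k)) ((γ k).prod (γ k)) := by
    split_ifs
    · exact Measure.measurePreserving_swap
    · exact .id _
  convert (hpair.comp (measurePreserving_pi _ _ hswap)).comp hpair.symm using 1
  ext p k <;> rcases eq_or_ne k l with rfl | hk <;>
    simp [swapCoord, *, MeasurableEquiv.arrowProdEquivProdArrow, Equiv.arrowProdEquivProdArrow]

lemma lintegral_mul_comp_le_of_involutive {Y : Type*} [MeasurableSpace Y] {M : Measure Y}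
    {τ : Y → Y} (hτ : MeasurePreserving τ M M) (hinv : Function.Involutive τ) {Q g : Y → ℝ≥0∞}
    (hQ : Measurable Q) (hg : Measurable g) (h : ∀ p, g p ≤ g (τ p) → Q p ≤ Q (τ p)) :
    ∫⁻ p, Q p * g (τ p) ∂M ≤ ∫⁻ p, Q p * g p ∂M := by
  have hpair (f : Y → ℝ≥0∞) (hf : Measurable f) :
      ∫⁻ p, f p + f (τ p) ∂M = 2 * ∫⁻ p, f p ∂M := by
    rw [lintegral_add_left hf, hτ.lintegral_comp hf, two_mul]
  have hrearr {a b c d : ℝ≥0∞} (hab : a ≤ b) (hcd : c ≤ d) : a * d + b * c ≤ a * c + b * d := by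
    obtain ⟨e, rfl⟩ := exists_add_of_le hab
    obtain ⟨f, rfl⟩ := exists_add_of_le hcd
    calc a * (c + f) + (a + e) * c ≤ a * (c + f) + (a + e) * c + e * f := le_self_add
      _ = a * c + (a + e) * (c + f) := by ring
  have key : 2 * ∫⁻ p, Q p * g (τ p) ∂M ≤ 2 * ∫⁻ p, Q p * g p ∂M := by
    rw [← hpair (fun p => Q p * g p) (hQ.mul hg),
      ← hpair (fun p => Q p * g (τ p)) (hQ.mul (hg.comp hτ.measurable))]
    refine lintegral_mono fun p => ?_
    rw [hinv p]
    rcases le_total (g p) (g (τ p)) with hp | hp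
    · exact hrearr (h p hp) hp
    · have hQp : Q (τ p) ≤ Q p := by simpa only [hinv p] using h (τ p) (by rwa [hinv p])
      simpa only [add_comm] using hrearr hQp hp
  exact (ENNReal.mul_le_mul_iff_right (by simp) (by simp)).1 key

lemma measurable_update_pair {ι Y : Type*} [DecidableEq ι] [MeasurableSpace Y] (i j : ι) :
    Measurable fun q : (Y × Y) × (ι → Y) =>
      Function.update (Function.update q.2 j q.1.2) i q.1.1 := by
  refine measurable_pi_iff.2 fun k => ?_
  simp only [Function.update_apply]
  split_ifs <;> fun_prop

lemma lintegral_pi_update_pair {ι : Type*} [Fintype ι] [DecidableEq ι] {Y : Type*}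
    [MeasurableSpace Y] (ν : ι → Measure Y) [∀ i, IsProbabilityMeasure (ν i)] (i j : ι)
    {f : (ι → Y) → ℝ≥0∞} (hf : Measurable f) :
    ∫⁻ p, ∫⁻ x, f (Function.update (Function.update x j p.2) i p.1) ∂Measure.pi ν
      ∂(ν i).prod (ν j) = ∫⁻ x, f x ∂Measure.pi ν := by
  calc ∫⁻ p, ∫⁻ x, f (Function.update (Function.update x j p.2) i p.1) ∂Measure.pi ν
        ∂(ν i).prod (ν j)
      = ∫⁻ a, ∫⁻ b, ∫⁻ x, f (Function.update (Function.update x j b) i a) ∂Measure.pi ν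
          ∂ν j ∂ν i :=
        lintegral_prod _ (hf.comp (measurable_update_pair i j)).lintegral_prod_right'.aemeasurable
    _ = ∫⁻ a, ∫⁻ x, f (Function.update x i a) ∂Measure.pi ν ∂ν i :=
        lintegral_congr fun a => lintegral_pi_update ν j (hf.comp measurable_update_left)
    _ = ∫⁻ x, f x ∂Measure.pi ν := lintegral_pi_update ν i hf

end Rearrangement

section Unimodality

/-- Symmetric unimodality of a measure on the line, in Anderson's form: centred intervals lose
mass as their centre moves away from the origin. The lower set `J` of squared distances makes the
condition cover open and closed intervals alike. -/
def IsSymmetricUnimodal (γ : Measure ℝ) : Prop :=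
  ∀ ⦃c c' : ℝ⦄, |c| ≤ |c'| → ∀ ⦃J : Set ℝ⦄, IsLowerSet J →
    γ {t | (t - c') ^ 2 ∈ J} ≤ γ {t | (t - c) ^ 2 ∈ J}

lemma isSymmetricUnimodal_withDensity {f : ℝ → ℝ≥0∞}
    (hanti : ∀ ⦃s t : ℝ⦄, |s| ≤ |t| → f t ≤ f s) :
    IsSymmetricUnimodal (volume.withDensity f) := by
  intro c c' hc J hJ
  have hm (c : ℝ) : MeasurableSet {t : ℝ | (t - c) ^ 2 ∈ J} :=
    (by fun_prop : Measurable fun t : ℝ => (t - c) ^ 2) hJ.ordConnected.measurableSet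
  set A := {t : ℝ | (t - c) ^ 2 ∈ J}
  set A' := {t : ℝ | (t - c') ^ 2 ∈ J}
  -- Reflecting in the midpoint of `c` and `c'` exchanges the two intervals.
  have hσ : (fun t => c + c' - t) ⁻¹' (A' \ A) = A \ A' := by
    ext t
    have h : (c + c' - t - c') ^ 2 = (t - c) ^ 2 := by ring
    have h' : (c + c' - t - c) ^ 2 = (t - c') ^ 2 := by ring
    simp [A, A', h, h']
  have hclosest {t : ℝ} (ht : t ∈ A \ A') : f (c + c' - t) ≤ f t := by
    refine hanti (sq_le_sq.1 ?_)
    have hlt : (t - c) ^ 2 < (t - c') ^ 2 := lt_of_not_ge fun h => ht.2 (hJ h ht.1)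
    have hp : 0 < (c' - c) * (c + c' - 2 * t) := by linarith
    have hq : 0 ≤ (c' - c) * (c + c') := by linarith [sq_le_sq.2 hc]
    have hne : 0 < (c' - c) ^ 2 := by have := left_ne_zero_of_mul hp.ne'; positivity
    have hpq : 0 ≤ (c' - c) ^ 2 * ((c + c') * (c + c' - 2 * t)) := by
      linarith [mul_nonneg hp.le hq]
    linarith [nonneg_of_mul_nonneg_right hpq hne]
  have hdiff : volume.withDensity f (A' \ A) ≤ volume.withDensity f (A \ A') := by
    rw [withDensity_apply f ((hm c').diff (hm c)), withDensity_apply f ((hm c).diff (hm c')),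
      ← (volume.measurePreserving_sub_left (c + c')).setLIntegral_comp_preimage_emb
        (MeasurableEquiv.subLeft (c + c')).measurableEmbedding, hσ]
    exact setLIntegral_mono' ((hm c).diff (hm c')) fun t ht => hclosest ht
  rw [← measure_inter_add_sdiff A' (hm c), ← measure_inter_add_sdiff A (hm c'), Set.inter_comm]
  gcongr

lemma isSymmetricUnimodal_gaussianReal (v : NNReal) : IsSymmetricUnimodal (gaussianReal 0 v) := by
  rcases eq_or_ne v 0 with rfl | hv
  · intro c c' hc J hJ
    have hmem : (0 - c') ^ 2 ∈ J → (0 - c) ^ 2 ∈ J := hJ (by simpa using sq_le_sq.2 hc)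
    rw [gaussianReal_zero_var]
    refine measure_mono_ae ?_
    rw [ae_dirac_eq]
    exact hmem
  · rw [gaussianReal_of_var_ne_zero _ hv]
    refine isSymmetricUnimodal_withDensity fun s t hst => ?_
    simp only [gaussianPDF, gaussianPDFReal, sub_zero]
    gcongr ENNReal.ofReal (_ * Real.exp (-?_ / _))
    exact sq_le_sq.2 hst

lemma measure_pi_sum_sq_sub_update_le {κ : Type*} [Fintype κ] [DecidableEq κ]
    {γ : κ → Measure ℝ} [∀ k, SigmaFinite (γ k)] (hγ : ∀ k, IsSymmetricUnimodal (γ k))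
    (a : κ → ℝ) (l : κ) {s t : ℝ} (hst : |s| ≤ |t|) {J : Set ℝ} (hJ : IsLowerSet J) :
    Measure.pi γ {z | ∑ k, (z k - Function.update a l t k) ^ 2 ∈ J} ≤
      Measure.pi γ {z | ∑ k, (z k - Function.update a l s k) ^ 2 ∈ J} := by
  have hm (s : ℝ) : MeasurableSet {z : κ → ℝ | ∑ k, (z k - Function.update a l s k) ^ 2 ∈ J} :=
    (by fun_prop : Measurable fun z : κ → ℝ => ∑ k, (z k - Function.update a l s k) ^ 2)
      hJ.ordConnected.measurableSet
  refine measure_pi_le_of_section_le l (hm t) (hm s) fun x => ?_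
  have hsec (s u : ℝ) : ∑ k, (Function.update x l u k - Function.update a l s k) ^ 2 =
      (u - s) ^ 2 + ∑ k ∈ Finset.univ.erase l, (x k - a k) ^ 2 := by
    rw [← Finset.add_sum_erase _ _ (Finset.mem_univ l)]
    congr 1
    · simp
    · refine Finset.sum_congr rfl fun k hk => ?_
      simp [Finset.ne_of_mem_erase hk]
  simp only [Set.mem_ofPred_eq, hsec]
  exact hγ l hst (J := (· + ∑ k ∈ Finset.univ.erase l, (x k - a k) ^ 2) ⁻¹' J)
    fun p q hpq hp => hJ (add_le_add_left hpq _) hp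

end Unimodality

section Nearest

lemma card_filter_card_filter_lt {α β : Type*} [LinearOrder β] {f : α → β}
    (hf : Function.Injective f) {s : Finset α} {K : ℕ} (hK : K ≤ s.card) :
    (s.filter fun j => (s.filter fun k => f k < f j).card < K).card = K := by
  set rank : α → ℕ := fun j => (s.filter fun k => f k < f j).card
  have rank_lt {j j' : α} (hj : j ∈ s) (h : f j < f j') : rank j < rank j' := by
    refine Finset.card_lt_card ⟨fun k hk => ?_, fun hsub => ?_⟩
    · simp only [Finset.mem_filter] at hk ⊢
      exact ⟨hk.1, hk.2.trans h⟩
    · exact lt_irrefl _ (Finset.mem_filter.1 (hsub (Finset.mem_filter.2 ⟨hj, h⟩))).2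
  have rank_inj : Set.InjOn rank s := fun j hj j' hj' h => by
    by_contra hne
    rcases (hf.ne hne).lt_or_gt with hlt | hlt
    · exact (rank_lt hj hlt).ne h
    · exact (rank_lt hj' hlt).ne' h
  have rank_image : s.image rank = Finset.range s.card := by
    refine Finset.eq_of_subset_of_card_le (fun r hr => ?_) ?_
    · obtain ⟨j, hj, rfl⟩ := Finset.mem_image.1 hr
      refine Finset.mem_range.2 (Finset.card_lt_card (Finset.filter_ssubset.2 ⟨j, hj, ?_⟩))
      exact lt_irrefl _
    · rw [Finset.card_range, Finset.card_image_of_injOn rank_inj]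
  calc (s.filter fun j => rank j < K).card
      = ((s.image rank).filter (· < K)).card := by
        rw [Finset.filter_image, Finset.card_image_of_injOn
          (rank_inj.mono (Finset.coe_subset.2 (Finset.filter_subset _ s)))]
    _ = (Finset.range K).card := by
        rw [rank_image]
        congr 1
        ext r
        simp only [Finset.mem_filter, Finset.mem_range]
        omega
    _ = K := Finset.card_range K

variable {n d K : ℕ}

lemma closer_iff_toLex_lt {x : Dataset n d} {i k j : Fin n} :
    Closer x i k j ↔ toLex (dist (x k) (x i), k) < toLex (dist (x j) (x i), j) := by
  rw [Prod.Lex.toLex_lt_toLex]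
  rfl

lemma mem_nearest_iff {x : Dataset n d} {i j : Fin n} :
    j ∈ nearest K x i ↔ j ≠ i ∧ {k | k ≠ i ∧ Closer x i k j}.ncard < K := by
  classical
  simp [nearest, Set.ncard_eq_toFinset_card']

lemma card_nearest (hKn : K < n) (x : Dataset n d) (i : Fin n) : (nearest K x i).card = K := by
  classical
  have hkey : Function.Injective fun k => toLex (dist (x k) (x i), k) := fun k j h =>
    (Prod.ext_iff.1 (toLex.injective h)).2
  have hK : K ≤ (Finset.univ.erase i).card := by
    rw [Finset.card_erase_of_mem (Finset.mem_univ i), Finset.card_fin]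
    omega
  refine (congrArg Finset.card ?_).trans (card_filter_card_filter_lt hkey hK)
  ext j
  simp only [nearest, closer_iff_toLex_lt, ← Finset.filter_ne', Finset.filter_filter]

lemma nearest_map_isometry {d' : ℕ} {f : Record d → Record d'} (hf : Isometry f)
    (x : Dataset n d) (i : Fin n) : nearest K (fun k => f (x k)) i = nearest K x i := by
  ext j
  simp only [mem_nearest_iff, Closer, hf.dist_eq]

end Nearest

section NeighbourProbability

variable {n d : ℕ}

/-- The coordinates `z` that come before the index `j`, carried by `p.2`, in the order seen from
`p.1` when they are carried by the index `k`. -/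
def closerBall (k j : Fin n) (p : (Fin d → ℝ) × (Fin d → ℝ)) : Set (Fin d → ℝ) :=
  {z | ∑ m, (z m - p.1 m) ^ 2 ∈
    {u | u < ∑ m, (p.2 m - p.1 m) ^ 2 ∨ (u = ∑ m, (p.2 m - p.1 m) ^ 2 ∧ k < j)}}

lemma isLowerSet_lt_or_eq_and {α : Type*} [LinearOrder α] (r : α) (p : Prop) :
    IsLowerSet {u : α | u < r ∨ (u = r ∧ p)} := by
  rintro u w hwu (hu | ⟨rfl, hp⟩)
  · exact Or.inl (hwu.trans_lt hu)
  · exact hwu.lt_or_eq.imp_right fun h => ⟨h, hp⟩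

lemma measurableSet_closerBall (k j : Fin n) (p : (Fin d → ℝ) × (Fin d → ℝ)) :
    MeasurableSet (closerBall k j p) :=
  (by fun_prop : Measurable fun z : Fin d → ℝ => ∑ m, (z m - p.1 m) ^ 2)
    (isLowerSet_lt_or_eq_and _ _).ordConnected.measurableSet

lemma measure_closerBall_swapCoord_le {γ : Fin d → Measure ℝ} [∀ l, IsProbabilityMeasure (γ l)]
    (hγ : ∀ l, IsSymmetricUnimodal (γ l)) (k j : Fin n) (l : Fin d)
    {p : (Fin d → ℝ) × (Fin d → ℝ)} (hp : |p.1 l| ≤ |p.2 l|) :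
    Measure.pi γ (closerBall k j (swapCoord l p)) ≤ Measure.pi γ (closerBall k j p) := by
  have hdist : ∑ m, ((swapCoord l p).2 m - (swapCoord l p).1 m) ^ 2 =
      ∑ m, (p.2 m - p.1 m) ^ 2 := by
    refine Finset.sum_congr rfl fun m _ => ?_
    rcases eq_or_ne m l with rfl | hm
    · simp only [swapCoord, Function.update_self]
      ring
    · simp [swapCoord, hm]
  rw [closerBall, closerBall, hdist]
  simpa only [swapCoord, Function.update_eq_self] using
    measure_pi_sum_sq_sub_update_le hγ p.1 l hp (isLowerSet_lt_or_eq_and _ _)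

/-- The event that `j` is one of the `K` nearest neighbours of `i` in the dataset with the
coordinates `y`. -/
def neighbourSet (K : ℕ) (i j : Fin n) : Set (Fin n → Fin d → ℝ) :=
  {y | j ∈ nearest K (fun k => WithLp.toLp 2 (y k)) i}

lemma measurableSet_neighbourSet (K : ℕ) (i j : Fin n) :
    MeasurableSet (neighbourSet K i j : Set (Fin n → Fin d → ℝ)) :=
  (by fun_prop : Measurable fun (y : Fin n → Fin d → ℝ) k => WithLp.toLp 2 (y k))
    (measurableSet_mem_nearest K i j)

/-- The conditional probability that `j` is one of the `K` nearest neighbours of `i`, given the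
coordinates `p.1` of the record `i` and `p.2` of the record `j`, when all records are independent
with law `ρ`. -/
noncomputable def neighbourProb (ρ : Measure (Fin d → ℝ)) (K : ℕ) (i j : Fin n)
    (p : (Fin d → ℝ) × (Fin d → ℝ)) : ℝ≥0∞ :=
  Measure.pi (fun _ => ρ)
    {y | Function.update (Function.update y j p.2) i p.1 ∈ neighbourSet K i j}

lemma closer_toLp_iff {y : Fin n → Fin d → ℝ} {i k j : Fin n} :
    Closer (fun k => (WithLp.toLp 2 (y k) : Record d)) i k j ↔
      y k ∈ closerBall k j (y i, y j) := by
  have hsq (k : Fin n) : dist (WithLp.toLp 2 (y k) : Record d) (WithLp.toLp 2 (y i)) ^ 2 =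
      ∑ m, (y k m - y i m) ^ 2 := by
    simp [EuclideanSpace.dist_sq_eq, Real.dist_eq, sq_abs]
  rw [Closer, ← sq_lt_sq₀ dist_nonneg dist_nonneg, ← sq_eq_sq₀ dist_nonneg dist_nonneg, hsq, hsq]
  rfl

lemma update_update_mem_neighbourSet_iff {K : ℕ} {i j : Fin n} (hij : i ≠ j)
    {p : (Fin d → ℝ) × (Fin d → ℝ)} {y : Fin n → Fin d → ℝ} :
    Function.update (Function.update y j p.2) i p.1 ∈ neighbourSet K i j ↔
      {k | y k ∈ {z | k ≠ i ∧ k ≠ j ∧ z ∈ closerBall k j p}}.ncard < K := by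
  have hself : p.2 ∉ closerBall j j p := by simp [closerBall]
  have hset : {k | k ≠ i ∧ Function.update (Function.update y j p.2) i p.1 k ∈ closerBall k j p} =
      {k | y k ∈ {z | k ≠ i ∧ k ≠ j ∧ z ∈ closerBall k j p}} := by
    ext k
    rcases eq_or_ne k i with rfl | hki
    · simp
    · rcases eq_or_ne k j with rfl | hkj
      · simp [hki, hself]
      · simp [hki, hkj]
  rw [neighbourSet, Set.mem_ofPred_eq, mem_nearest_iff, ← hset]
  simp [closer_toLp_iff, hij.symm]

variable {K : ℕ} {i j : Fin n}

lemma neighbourProb_le_swapCoord {γ : Fin d → Measure ℝ} [∀ l, IsProbabilityMeasure (γ l)]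
    (hγ : ∀ l, IsSymmetricUnimodal (γ l)) (hij : i ≠ j) (l : Fin d)
    {p : (Fin d → ℝ) × (Fin d → ℝ)} (hp : |p.1 l| ≤ |p.2 l|) :
    neighbourProb (Measure.pi γ) K i j p ≤ neighbourProb (Measure.pi γ) K i j (swapCoord l p) := by
  have hlower : IsLowerSet {U : Set (Fin n) | U.ncard < K} := fun U V hVU hU =>
    (Set.ncard_le_ncard hVU).trans_lt hU
  have hm (k : Fin n) (p : (Fin d → ℝ) × (Fin d → ℝ)) :
      MeasurableSet {z | k ≠ i ∧ k ≠ j ∧ z ∈ closerBall k j p} :=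
    (MeasurableSet.const _).inter ((MeasurableSet.const _).inter (measurableSet_closerBall k j p))
  simp only [neighbourProb, update_update_mem_neighbourSet_iff hij]
  refine measure_pi_mem_le_of_isLowerSet (fun k => hm k (swapCoord l p)) (fun k => hm k p)
    (fun k => ?_) hlower
  by_cases hk : k ≠ i ∧ k ≠ j
  · simpa [hk] using measure_closerBall_swapCoord_le hγ k j l hp
  · have hempty (p : (Fin d → ℝ) × (Fin d → ℝ)) :
        {z | k ≠ i ∧ k ≠ j ∧ z ∈ closerBall k j p} = ∅ :=
      Set.eq_empty_of_forall_notMem fun z hz => hk ⟨hz.1, hz.2.1⟩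
    simp [hempty]

lemma measurable_neighbourProb (ρ : Measure (Fin d → ℝ)) [IsProbabilityMeasure ρ] (K : ℕ)
    (i j : Fin n) : Measurable (neighbourProb ρ K i j) :=
  measurable_measure_prodMk_left (measurable_update_pair i j (measurableSet_neighbourSet K i j))

lemma setLIntegral_neighbourSet (ρ : Measure (Fin d → ℝ)) [IsProbabilityMeasure ρ] (hij : i ≠ j)
    {g : (Fin d → ℝ) × (Fin d → ℝ) → ℝ≥0∞} (hg : Measurable g) :
    ∫⁻ y in neighbourSet K i j, g (y i, y j) ∂Measure.pi (fun _ => ρ) =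
      ∫⁻ p, neighbourProb ρ K i j p * g p ∂ρ.prod ρ := by
  have hgm : Measurable fun y : Fin n → Fin d → ℝ => g (y i, y j) := by fun_prop
  have hm := measurableSet_neighbourSet (n := n) (d := d) K i j
  rw [← lintegral_indicator hm, ← lintegral_pi_update_pair (fun _ => ρ) i j (hgm.indicator hm)]
  refine lintegral_congr fun p => ?_
  have hmp : Measurable fun y : Fin n → Fin d → ℝ =>
      Function.update (Function.update y j p.2) i p.1 :=
    (measurable_update_pair i j).comp measurable_prodMk_left
  rw [neighbourProb, mul_comm]
  refine Eq.trans ?_ (lintegral_indicator_const (hmp hm) (g p))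
  refine lintegral_congr fun y => ?_
  by_cases hy : Function.update (Function.update y j p.2) i p.1 ∈ neighbourSet K i j
  · simp [Set.indicator_of_mem, hy, hij.symm]
  · simp [Set.indicator_of_notMem, hy]

lemma setLIntegral_neighbourSet_coord_sq_le {γ : Fin d → Measure ℝ}
    [∀ l, IsProbabilityMeasure (γ l)] (hγ : ∀ l, IsSymmetricUnimodal (γ l)) (hij : i ≠ j)
    (l : Fin d) :
    ∫⁻ y in neighbourSet K i j, ENNReal.ofReal (y j l ^ 2) ∂Measure.pi (fun _ => Measure.pi γ) ≤
      ∫⁻ y in neighbourSet K i j, ENNReal.ofReal (y i l ^ 2)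
        ∂Measure.pi (fun _ => Measure.pi γ) := by
  have hg : Measurable fun p : (Fin d → ℝ) × (Fin d → ℝ) => ENNReal.ofReal (p.1 l ^ 2) := by
    fun_prop
  rw [setLIntegral_neighbourSet (Measure.pi γ) hij hg, setLIntegral_neighbourSet (Measure.pi γ) hij
    (g := fun p => ENNReal.ofReal (p.2 l ^ 2)) (by fun_prop)]
  convert lintegral_mul_comp_le_of_involutive (measurePreserving_swapCoord γ l)
    (involutive_swapCoord l) (measurable_neighbourProb (Measure.pi γ) K i j) hg ?_ using 2
  · simp [swapCoord]
  · intro p hp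
    refine neighbourProb_le_swapCoord hγ hij l (sq_le_sq.1 ?_)
    simpa [swapCoord, ENNReal.ofReal_le_ofReal_iff, sq_nonneg] using hp

end NeighbourProbability

section PrincipalAxes

variable {ι : Type*} [Fintype ι] [DecidableEq ι] {S : Matrix ι ι ℝ}

lemma inner_eigenvectorBasis_mulVec (hS : S.IsHermitian) (k : ι) (t : EuclideanSpace ℝ ι) :
    inner ℝ (hS.eigenvectorBasis k) (WithLp.toLp 2 (S.mulVec t)) =
      hS.eigenvalues k * inner ℝ (hS.eigenvectorBasis k) t := by
  have hT : S.transpose = S := (Matrix.conjTranspose_eq_transpose_of_trivial S).symm.trans hS.eq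
  have hinner (u w : EuclideanSpace ℝ ι) : inner ℝ u w = u.ofLp ⬝ᵥ w.ofLp := by
    simp [PiLp.inner_apply, dotProduct, mul_comm]
  rw [hinner, hinner, Matrix.dotProduct_mulVec, ← Matrix.mulVec_transpose, hT,
    hS.mulVec_eigenvectorBasis, smul_dotProduct, smul_eq_mul]

lemma dotProduct_mulVec_eq_sum_eigenvalues (hS : S.IsHermitian) (t : EuclideanSpace ℝ ι) :
    t.ofLp ⬝ᵥ S.mulVec t.ofLp =
      ∑ k, hS.eigenvalues k * inner ℝ (hS.eigenvectorBasis k) t ^ 2 :=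
  calc t.ofLp ⬝ᵥ S.mulVec t.ofLp = inner ℝ t (WithLp.toLp 2 (S.mulVec t)) := by
        simp [PiLp.inner_apply, dotProduct, mul_comm]
    _ = ∑ k, hS.eigenvalues k * inner ℝ (hS.eigenvectorBasis k) t ^ 2 := by
        rw [← hS.eigenvectorBasis.sum_inner_mul_inner]
        refine Finset.sum_congr rfl fun k _ => ?_
        rw [inner_eigenvectorBasis_mulVec, real_inner_comm]
        ring

lemma charFun_map_linearIsometryEquiv {E F : Type*} [NormedAddCommGroup E]
    [InnerProductSpace ℝ E] [MeasurableSpace E] [BorelSpace E] [NormedAddCommGroup F]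
    [InnerProductSpace ℝ F] [MeasurableSpace F] [BorelSpace F] (P : Measure E) (Φ : E ≃ₗᵢ[ℝ] F)
    (t : F) : charFun (P.map Φ) t = charFun P (Φ.symm t) := by
  have hmap : P.map Φ = P.map Φ.toHomeomorph.toMeasurableEquiv := rfl
  rw [charFun_apply, charFun_apply, hmap, integral_map_equiv]
  simp_rw [← Φ.inner_map_eq_flip]
  rfl

lemma multivariateGaussian_eq_map_pi_gaussianReal (μ : EuclideanSpace ℝ ι) (hS : S.PosSemidef) :
    multivariateGaussian μ S =
      (Measure.pi fun k => gaussianReal 0 (hS.isHermitian.eigenvalues k).toNNReal).map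
        fun y => μ + hS.isHermitian.eigenvectorBasis.repr.symm (WithLp.toLp 2 y) := by
  set b := hS.isHermitian.eigenvectorBasis
  set ρ := Measure.pi fun k => gaussianReal 0 (hS.isHermitian.eigenvalues k).toNNReal
  have hmap : ρ.map (fun y => μ + b.repr.symm (WithLp.toLp 2 y)) =
      ((ρ.map (WithLp.toLp 2)).map b.repr.symm).map (μ + ·) := by
    rw [Measure.map_map (by fun_prop) (by fun_prop), Measure.map_map (by fun_prop) (by fun_prop)]
    rfl
  have : IsProbabilityMeasure (ρ.map fun y => μ + b.repr.symm (WithLp.toLp 2 y)) :=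
    Measure.isProbabilityMeasure_map (by fun_prop)
  refine Measure.ext_of_charFun (funext fun t => ?_)
  rw [hmap, charFun_map_const_add, charFun_map_linearIsometryEquiv, charFun_pi,
    charFun_multivariateGaussian hS, dotProduct_mulVec_eq_sum_eigenvalues hS.isHermitian]
  simp only [charFun_gaussianReal, ← Complex.exp_sum, ← Complex.exp_add]
  congr 1
  simp [b, OrthonormalBasis.repr_apply_apply, Real.coe_toNNReal _ (hS.eigenvalues_nonneg _),
    real_inner_comm, Finset.sum_div]
  ring

end PrincipalAxes

section GaussianNeighbour

variable {n d : ℕ} {S : Matrix (Fin d) (Fin d) ℝ}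

lemma setLIntegral_mem_nearest_norm_sq_le (K : ℕ) (μ : Record d) (hS : S.PosSemidef)
    (i j : Fin n) :
    ∫⁻ x in {x | j ∈ nearest K x i}, ENNReal.ofReal (‖x j - μ‖ ^ 2) ∂gaussianData n (μ, S) ≤
      ∫⁻ x in {x | j ∈ nearest K x i}, ENNReal.ofReal (‖x i - μ‖ ^ 2) ∂gaussianData n (μ, S) := by
  rcases eq_or_ne i j with rfl | hij
  · rfl
  set v := fun k => (hS.isHermitian.eigenvalues k).toNNReal
  set Φ := hS.isHermitian.eigenvectorBasis.repr.symm
  set G : (Fin n → Fin d → ℝ) → Dataset n d := fun y k => μ + Φ (WithLp.toLp 2 (y k))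
  have hG : MeasurePreserving G (Measure.pi fun _ => Measure.pi fun k => gaussianReal 0 (v k))
      (gaussianData n (μ, S)) :=
    measurePreserving_pi _ _ fun _ =>
      ⟨by fun_prop, (multivariateGaussian_eq_map_pi_gaussianReal μ hS).symm⟩
  have hpre : G ⁻¹' {x | j ∈ nearest K x i} = neighbourSet K i j := by
    have hφ : Isometry fun z => μ + Φ z := (isometry_add_left μ).comp Φ.isometry
    ext y
    exact Finset.ext_iff.1 (nearest_map_isometry hφ (fun k => WithLp.toLp 2 (y k)) i) j
  have hcoord (k : Fin n) :
      ∫⁻ x in {x | j ∈ nearest K x i}, ENNReal.ofReal (‖x k - μ‖ ^ 2) ∂gaussianData n (μ, S) =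
        ∑ l, ∫⁻ y in neighbourSet K i j, ENNReal.ofReal (y k l ^ 2)
          ∂Measure.pi fun _ => Measure.pi fun k => gaussianReal 0 (v k) := by
    rw [← hG.setLIntegral_comp_preimage (measurableSet_mem_nearest K i j) (by fun_prop), hpre,
      ← lintegral_finsetSum _ fun l _ => by fun_prop]
    refine lintegral_congr fun y => ?_
    rw [add_sub_cancel_left, Φ.norm_map, EuclideanSpace.real_norm_sq_eq,
      ENNReal.ofReal_sum_of_nonneg fun l _ => sq_nonneg _]
  rw [hcoord, hcoord]
  exact Finset.sum_le_sum fun l _ => setLIntegral_neighbourSet_coord_sq_le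
    (fun k => isSymmetricUnimodal_gaussianReal (v k)) hij l

end GaussianNeighbour

section SegmentMoments

variable {E : Type*} [NormedAddCommGroup E] [InnerProductSpace ℝ E]

lemma integral_norm_segment_sq (a b : E) :
    ∫ w in Set.Icc (0 : ℝ) 1, ‖a + w • (b - a)‖ ^ 2 =
      (‖a‖ ^ 2 + ‖b‖ ^ 2) / 2 - ‖a - b‖ ^ 2 / 6 := by
  have hexpand (w : ℝ) : ‖a + w • (b - a)‖ ^ 2 =
      ‖a‖ ^ 2 + (w * (‖b‖ ^ 2 - ‖a‖ ^ 2 - ‖a - b‖ ^ 2) + w ^ 2 * ‖a - b‖ ^ 2) := by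
    have hb : ‖b‖ ^ 2 = ‖a‖ ^ 2 + 2 * inner ℝ a (b - a) + ‖b - a‖ ^ 2 := by
      rw [← norm_add_sq_real, add_sub_cancel]
    rw [norm_add_sq_real, inner_smul_right, norm_smul, mul_pow, Real.norm_eq_abs, sq_abs,
      norm_sub_rev a b, hb]
    ring
  simp_rw [hexpand]
  rw [integral_Icc_eq_integral_Ioc, ← intervalIntegral.integral_of_le zero_le_one,
    intervalIntegral.integral_add (by simp) (Continuous.intervalIntegrable (by fun_prop) _ _),
    intervalIntegral.integral_add (Continuous.intervalIntegrable (by fun_prop) _ _)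
      (Continuous.intervalIntegrable (by fun_prop) _ _),
    intervalIntegral.integral_mul_const, intervalIntegral.integral_mul_const, integral_id,
    integral_pow]
  simp only [intervalIntegral.integral_const]
  norm_num
  ring

lemma lintegral_norm_segment_sub_sq (a b c : E) :
    (∫⁻ w in Set.Icc (0 : ℝ) 1, ENNReal.ofReal (‖a + w • (b - a) - c‖ ^ 2)) +
        ENNReal.ofReal (‖a - b‖ ^ 2 / 6) =
      ENNReal.ofReal (‖a - c‖ ^ 2 / 2) + ENNReal.ofReal (‖b - c‖ ^ 2 / 2) := by
  have hint : IntegrableOn (fun w : ℝ => ‖a + w • (b - a) - c‖ ^ 2) (Set.Icc 0 1) :=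
    (Continuous.continuousOn (by fun_prop)).integrableOn_Icc
  have hmoment : ∫ w in Set.Icc (0 : ℝ) 1, ‖a + w • (b - a) - c‖ ^ 2 =
      (‖a - c‖ ^ 2 + ‖b - c‖ ^ 2) / 2 - ‖a - b‖ ^ 2 / 6 := by
    simpa only [sub_sub_sub_cancel_right, sub_add_eq_add_sub] using
      integral_norm_segment_sq (a - c) (b - c)
  rw [← ofReal_integral_eq_lintegral_ofReal hint (Filter.Eventually.of_forall fun _ => sq_nonneg _),
    ← ENNReal.ofReal_add (integral_nonneg fun _ => sq_nonneg _) (by positivity),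
    ← ENNReal.ofReal_add (by positivity) (by positivity), hmoment]
  congr 1
  ring

end SegmentMoments

section Moments

variable {E : Type*} [NormedAddCommGroup E] [MeasurableSpace E] [BorelSpace E]
  [SecondCountableTopology E] {M : Measure E} [IsProbabilityMeasure M]

lemma integrable_id_of_lintegral_norm_sub_sq_ne_top {c : E}
    (h : ∫⁻ z, ENNReal.ofReal (‖z - c‖ ^ 2) ∂M ≠ ∞) : Integrable (fun z => z) M := by
  have hmem : MemLp (fun z => z - c) 2 M :=
    (memLp_two_iff_integrable_sq_norm (by fun_prop)).2
      ⟨by fun_prop, (hasFiniteIntegral_iff_ofReal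
        (Filter.Eventually.of_forall fun _ => sq_nonneg _)).2 h.lt_top⟩
  have hsub : Integrable (fun z => z - c) M := hmem.integrable one_le_two
  exact (hsub.add (integrable_const c)).congr (Filter.Eventually.of_forall fun z =>
    sub_add_cancel z c)

lemma integral_id_eq_of_map_pointReflection [NormedSpace ℝ E] [CompleteSpace E] {c : E}
    (hint : Integrable (fun z => z) M)
    (hM : M.map (AffineIsometryEquiv.pointReflection ℝ c) = M) : ∫ z, z ∂M = c := by
  have hmean : ∫ z, z ∂M = c - ∫ z, z ∂M + c := by
    conv_lhs => rw [← hM]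
    rw [integral_map (AffineIsometryEquiv.continuous _).aemeasurable (by fun_prop)]
    simp only [AffineIsometryEquiv.pointReflection_apply, vsub_eq_sub, vadd_eq_add]
    rw [integral_add (f := fun z => c - z) ((integrable_const c).sub hint) (integrable_const c),
      integral_sub (integrable_const c) hint]
    simp
  have htwo : (2 : ℝ) • ∫ z, z ∂M = (2 : ℝ) • c := by
    rw [two_smul, two_smul]
    nth_rewrite 1 [hmean]
    abel
  exact smul_right_injective E (two_ne_zero (α := ℝ)) htwo

variable {ι : Type*} [Fintype ι]

lemma ofReal_sum_variance_eval {M : Measure (EuclideanSpace ℝ ι)} [IsProbabilityMeasure M]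
    {c : EuclideanSpace ℝ ι} (h : ∫⁻ z, ENNReal.ofReal (‖z - c‖ ^ 2) ∂M ≠ ∞)
    (hc : ∫ z, z ∂M = c) :
    ENNReal.ofReal (∑ a, Var[fun z : EuclideanSpace ℝ ι => z a; M]) =
      ∫⁻ z, ENNReal.ofReal (‖z - c‖ ^ 2) ∂M := by
  have hmean (a : ι) : ∫ z : EuclideanSpace ℝ ι, z a ∂M = c a := by
    have hproj := (EuclideanSpace.proj (𝕜 := ℝ) a).integral_comp_comm
      (integrable_id_of_lintegral_norm_sub_sq_ne_top h)
    rw [hc] at hproj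
    simpa using hproj
  have hsum : ∫⁻ z, ENNReal.ofReal (‖z - c‖ ^ 2) ∂M =
      ∑ a, eVar[fun z : EuclideanSpace ℝ ι => z a; M] := by
    simp_rw [evariance_eq_lintegral_ofReal, hmean]
    rw [← lintegral_finsetSum _ fun a _ => by fun_prop]
    refine lintegral_congr fun z => ?_
    rw [EuclideanSpace.real_norm_sq_eq, ENNReal.ofReal_sum_of_nonneg fun a _ => sq_nonneg _]
    simp only [PiLp.sub_apply]
  rw [hsum] at h ⊢
  rw [ENNReal.ofReal_sum_of_nonneg fun a _ => variance_nonneg _ _]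
  exact Finset.sum_congr rfl fun a _ =>
    ENNReal.ofReal_toReal (ENNReal.sum_ne_top.1 h a (Finset.mem_univ a))

end Moments

section MultivariateGaussian

variable {ι : Type*} [Fintype ι] [DecidableEq ι] (μ : EuclideanSpace ℝ ι) {S : Matrix ι ι ℝ}

lemma lintegral_norm_sub_sq_multivariateGaussian (hS : S.PosSemidef) :
    ∫⁻ z, ENNReal.ofReal (‖z - μ‖ ^ 2) ∂multivariateGaussian μ S = ENNReal.ofReal S.trace := by
  have hmem : MemLp (fun z => z - μ) 2 (multivariateGaussian μ S) :=
    IsGaussian.memLp_two_id.sub (memLp_const μ)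
  have hint := hmem.integrable_norm_pow (by simp)
  rw [← ofReal_sum_variance_eval _ integral_id_multivariateGaussian]
  · simp_rw [variance_eval_multivariateGaussian hS]
    rfl
  · rw [← ofReal_integral_eq_lintegral_ofReal hint
      (Filter.Eventually.of_forall fun _ => sq_nonneg _)]
    exact ENNReal.ofReal_ne_top

lemma nullSingletonClass_multivariateGaussian (hS : S.PosSemidef) (hS0 : S ≠ 0) :
    NullSingletonClass (multivariateGaussian μ S) := by
  obtain ⟨l, hl⟩ : ∃ l, S l l ≠ 0 := by
    by_contra! h
    exact hS0 (hS.trace_eq_zero_iff.1 (Finset.sum_eq_zero fun l _ => h l))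
  have := nullSingletonClass_gaussianReal (μ := μ l)
    (Real.toNNReal_pos.2 (hS.diag_nonneg.lt_of_ne' hl)).ne'
  refine ⟨fun p => measure_mono_null (t := (fun x : EuclideanSpace ℝ ι => x l) ⁻¹' {p l})
    (by rintro _ rfl; rfl) ?_⟩
  rw [(measurePreserving_eval_multivariateGaussian hS).measure_preimage
    (measurableSet_singleton _).nullMeasurableSet]
  exact measure_singleton _

lemma multivariateGaussian_map_pointReflection (S : Matrix ι ι ℝ) :
    (multivariateGaussian μ S).map (AffineIsometryEquiv.pointReflection ℝ μ) =
      multivariateGaussian μ S := by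
  have hneg := stdGaussian_map (LinearIsometryEquiv.neg ℝ (E := EuclideanSpace ℝ ι))
  have hrefl := (AffineIsometryEquiv.pointReflection ℝ μ).continuous.measurable
  rw [multivariateGaussian, Measure.map_map hrefl (by fun_prop)]
  conv_rhs => rw [← hneg]
  rw [Measure.map_map (by fun_prop) (by fun_prop)]
  congr 1
  ext1 x
  simp [AffineIsometryEquiv.pointReflection_apply, add_comm]

end MultivariateGaussian

section SegmentLaw

variable {d d' : ℕ}

lemma lintegral_segmentLaw (a b : Record d) {f : Record d → ℝ≥0∞} (hf : Measurable f) :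
    ∫⁻ z, f z ∂segmentLaw a b = ∫⁻ w in Set.Icc (0 : ℝ) 1, f (a + w • (b - a)) :=
  lintegral_map hf (by fun_prop)

lemma measurable_lintegral_segmentLaw {f : Record d → ℝ≥0∞} (hf : Measurable f) :
    Measurable fun p : Record d × Record d => ∫⁻ z, f z ∂segmentLaw p.1 p.2 := by
  simp_rw [lintegral_segmentLaw _ _ hf]
  exact (hf.comp (by fun_prop : Measurable fun q : (Record d × Record d) × ℝ =>
    q.1.1 + q.2 • (q.1.2 - q.1.1))).lintegral_prod_right'

lemma segmentLaw_map (f : Record d →ᵃⁱ[ℝ] Record d') (a b : Record d) :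
    segmentLaw (f a) (f b) = (segmentLaw a b).map f := by
  rw [segmentLaw, segmentLaw, Measure.map_map f.continuous.measurable (by fun_prop)]
  congr 1
  ext1 w
  simpa [AffineMap.lineMap_apply, add_comm] using (f.toAffineMap.apply_lineMap a b w).symm

lemma lintegral_segmentLaw_norm_sub_sq_lt {Q : Measure (Record d × Record d)}
    [IsProbabilityMeasure Q] (hQ : Q {p | p.1 = p.2} = 0) {c : Record d}
    (hle : ∫⁻ p, ENNReal.ofReal (‖p.2 - c‖ ^ 2) ∂Q ≤ ∫⁻ p, ENNReal.ofReal (‖p.1 - c‖ ^ 2) ∂Q)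
    (hfin : ∫⁻ p, ENNReal.ofReal (‖p.1 - c‖ ^ 2) ∂Q ≠ ∞) :
    ∫⁻ p, ∫⁻ z, ENNReal.ofReal (‖z - c‖ ^ 2) ∂segmentLaw p.1 p.2 ∂Q <
      ∫⁻ p, ENNReal.ofReal (‖p.1 - c‖ ^ 2) ∂Q := by
  have hhalf (u : ℝ) : ENNReal.ofReal (u / 2) = ENNReal.ofReal 2⁻¹ * ENNReal.ofReal u := by
    rw [← ENNReal.ofReal_mul (by norm_num), inv_mul_eq_div]
  have hsum : ∫⁻ p, ∫⁻ z, ENNReal.ofReal (‖z - c‖ ^ 2) ∂segmentLaw p.1 p.2 ∂Q +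
      ∫⁻ p, ENNReal.ofReal (‖p.1 - p.2‖ ^ 2 / 6) ∂Q ≤
        ∫⁻ p, ENNReal.ofReal (‖p.1 - c‖ ^ 2) ∂Q :=
    calc _ = ENNReal.ofReal 2⁻¹ * ∫⁻ p, ENNReal.ofReal (‖p.1 - c‖ ^ 2) ∂Q +
          ENNReal.ofReal 2⁻¹ * ∫⁻ p, ENNReal.ofReal (‖p.2 - c‖ ^ 2) ∂Q := by
          rw [← lintegral_add_right _ (by fun_prop), ← lintegral_const_mul _ (by fun_prop),
            ← lintegral_const_mul _ (by fun_prop), ← lintegral_add_right _ (by fun_prop)]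
          simp_rw [lintegral_segmentLaw _ _
            (by fun_prop : Measurable fun z : Record d => ENNReal.ofReal (‖z - c‖ ^ 2)),
            lintegral_norm_segment_sub_sq, hhalf]
      _ ≤ ENNReal.ofReal 2⁻¹ * ∫⁻ p, ENNReal.ofReal (‖p.1 - c‖ ^ 2) ∂Q +
          ENNReal.ofReal 2⁻¹ * ∫⁻ p, ENNReal.ofReal (‖p.1 - c‖ ^ 2) ∂Q := by gcongr
      _ = ∫⁻ p, ENNReal.ofReal (‖p.1 - c‖ ^ 2) ∂Q := by
          rw [← add_mul, ← ENNReal.ofReal_add (by norm_num) (by norm_num)]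
          norm_num
  have hgap : ∫⁻ p, ENNReal.ofReal (‖p.1 - p.2‖ ^ 2 / 6) ∂Q ≠ 0 := by
    intro h
    rw [lintegral_eq_zero_iff (by fun_prop)] at h
    have hne : ∀ᵐ p ∂Q, p.1 ≠ p.2 := by simpa [ae_iff] using hQ
    obtain ⟨p, hp, hp'⟩ := (h.and hne).exists
    have hpos : 0 < ‖p.1 - p.2‖ := norm_sub_pos_iff.2 hp'
    exact (ENNReal.ofReal_pos.2 (by positivity)).ne' hp
  exact (ENNReal.lt_add_right (ne_top_of_le_ne_top hfin (le_self_add.trans hsum)) hgap).trans_le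
    hsum

end SegmentLaw

section NeighbourPair

variable {n d K : ℕ}

/-- The law of the pair `(x i, x j)` of a uniformly chosen base record and a uniformly chosen one
of its `K` nearest neighbours, for a random dataset `x` with law `P`: the endpoints of the segment
on which a SMOTE sample lies. -/
noncomputable def neighbourPairLaw (K : ℕ) (P : Measure (Dataset n d)) :
    Measure (Record d × Record d) :=
  (n : ℝ≥0∞)⁻¹ • ∑ i, (K : ℝ≥0∞)⁻¹ •
    ∑ j, (P.restrict {x | j ∈ nearest K x i}).map fun x => (x i, x j)

lemma lintegral_neighbourPairLaw (P : Measure (Dataset n d)) {f : Record d × Record d → ℝ≥0∞}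
    (hf : Measurable f) :
    ∫⁻ p, f p ∂neighbourPairLaw K P = (n : ℝ≥0∞)⁻¹ * ∑ i, (K : ℝ≥0∞)⁻¹ *
      ∑ j, ∫⁻ x in {x | j ∈ nearest K x i}, f (x i, x j) ∂P := by
  have hmap (i j : Fin n) : ∫⁻ p, f p ∂(P.restrict {x | j ∈ nearest K x i}).map
      (fun x => (x i, x j)) = ∫⁻ x in {x | j ∈ nearest K x i}, f (x i, x j) ∂P :=
    lintegral_map hf (by fun_prop)
  simp only [neighbourPairLaw, lintegral_smul_measure, lintegral_finsetSum_measure, smul_eq_mul,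
    hmap]

lemma sum_nearest_eq_sum_indicator (x : Dataset n d) (i : Fin n)
    (g : Fin n → Dataset n d → ℝ≥0∞) :
    ∑ j ∈ nearest K x i, g j x = ∑ j, {x | j ∈ nearest K x i}.indicator (g j) x := by
  classical
  simp only [Set.indicator_apply, Set.mem_ofPred_eq, Finset.sum_ite_mem, Finset.univ_inter]

lemma measurable_sum_nearest (i : Fin n) {g : Fin n → Dataset n d → ℝ≥0∞}
    (hg : ∀ j, Measurable (g j)) : Measurable fun x => ∑ j ∈ nearest K x i, g j x := by
  simp_rw [sum_nearest_eq_sum_indicator]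
  exact Finset.measurable_sum _ fun j _ => (hg j).indicator (measurableSet_mem_nearest K i j)

lemma lintegral_sum_nearest (P : Measure (Dataset n d)) (i : Fin n)
    {g : Fin n → Dataset n d → ℝ≥0∞} (hg : ∀ j, Measurable (g j)) :
    ∫⁻ x, ∑ j ∈ nearest K x i, g j x ∂P =
      ∑ j, ∫⁻ x in {x | j ∈ nearest K x i}, g j x ∂P := by
  simp_rw [sum_nearest_eq_sum_indicator,
    ← lintegral_indicator (measurableSet_mem_nearest (d := d) K i _)]
  exact lintegral_finsetSum _ fun j _ => (hg j).indicator (measurableSet_mem_nearest K i j)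

lemma lintegral_bind_smoteSample (hKn : K < n) (P : Measure (Dataset n d))
    {f : Record d → ℝ≥0∞} (hf : Measurable f) :
    ∫⁻ z, f z ∂P.bind (smoteSample K) =
      ∫⁻ p, ∫⁻ z, f z ∂segmentLaw p.1 p.2 ∂neighbourPairLaw K P := by
  have hseg := measurable_lintegral_segmentLaw hf
  have hg (i j : Fin n) :
      Measurable fun x : Dataset n d => ∫⁻ z, f z ∂segmentLaw (x i) (x j) :=
    hseg.comp (by fun_prop : Measurable fun x : Dataset n d => (x i, x j))
  have hsample (x : Dataset n d) : ∫⁻ z, f z ∂smoteSample K x = (n : ℝ≥0∞)⁻¹ * ∑ i,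
      (K : ℝ≥0∞)⁻¹ * ∑ j ∈ nearest K x i, ∫⁻ z, f z ∂segmentLaw (x i) (x j) := by
    simp only [smoteSample, lintegral_smul_measure, lintegral_finsetSum_measure, smul_eq_mul,
      card_nearest hKn]
  rw [Measure.lintegral_bind (measurable_smoteSample K).aemeasurable hf.aemeasurable,
    lintegral_neighbourPairLaw P hseg]
  simp_rw [hsample]
  rw [lintegral_const_mul _ (Finset.measurable_sum _ fun i _ =>
      (measurable_sum_nearest i (hg i)).const_mul _),
    lintegral_finsetSum _ fun i _ => (measurable_sum_nearest i (hg i)).const_mul _]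
  simp_rw [lintegral_const_mul _ (measurable_sum_nearest _ (hg _)),
    lintegral_sum_nearest P _ (hg _)]

lemma lintegral_neighbourPairLaw_fst (hK : 1 ≤ K) (hKn : K < n) (P : Measure (Dataset n d))
    {f : Record d → ℝ≥0∞} (hf : Measurable f) :
    ∫⁻ p, f p.1 ∂neighbourPairLaw K P = ∫⁻ z, f z ∂recordLaw P := by
  have hK0 : (K : ℝ≥0∞) ≠ 0 := by exact_mod_cast (by omega : K ≠ 0)
  have hcount (i : Fin n) :
      ∑ j, ∫⁻ x in {x | j ∈ nearest K x i}, f (x i) ∂P = K * ∫⁻ x, f (x i) ∂P := by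
    rw [← lintegral_sum_nearest P i fun _ => by fun_prop, ← lintegral_const_mul _ (by fun_prop)]
    simp only [Finset.sum_const, card_nearest hKn, nsmul_eq_mul]
  have hmap (i : Fin n) : ∫⁻ z, f z ∂P.map (fun x => x i) = ∫⁻ x, f (x i) ∂P :=
    lintegral_map hf (measurable_pi_apply i)
  rw [lintegral_neighbourPairLaw P (f := fun p => f p.1) (by fun_prop)]
  simp only [hcount, ENNReal.inv_mul_cancel_left hK0 (ENNReal.natCast_ne_top K), recordLaw,
    lintegral_smul_measure, lintegral_finsetSum_measure, smul_eq_mul, hmap]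

lemma neighbourPairLaw_diagonal {P : Measure (Dataset n d)}
    (hP : ∀ i j, i ≠ j → P {x | x i = x j} = 0) :
    neighbourPairLaw K P {p | p.1 = p.2} = 0 := by
  have hdiag : MeasurableSet {p : Record d × Record d | p.1 = p.2} :=
    measurableSet_eq_fun measurable_fst measurable_snd
  have hpair (i j : Fin n) : (P.restrict {x | j ∈ nearest K x i}).map (fun x => (x i, x j))
      {p | p.1 = p.2} = 0 := by
    rw [Measure.map_apply (by fun_prop) hdiag]
    rcases eq_or_ne i j with rfl | hij
    · simp [mem_nearest_iff]
    · exact nonpos_iff_eq_zero.1 ((Measure.restrict_apply_le _ _).trans (hP i j hij).le)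
  simp [neighbourPairLaw, hpair]

end NeighbourPair

section RecordLaw

variable {n m d K : ℕ}

lemma isProbabilityMeasure_smoteSample (hK : 1 ≤ K) (hKn : K < n) (x : Dataset n d) :
    IsProbabilityMeasure (smoteSample K x) := by
  have hK0 : (K : ℝ≥0∞) ≠ 0 := by exact_mod_cast (by omega : K ≠ 0)
  have hn0 : (n : ℝ≥0∞) ≠ 0 := by exact_mod_cast (by omega : n ≠ 0)
  refine ⟨?_⟩
  simp only [smoteSample, Measure.smul_apply, Measure.coe_finsetSum, Finset.sum_apply,
    measure_univ, smul_eq_mul, Finset.sum_const, nsmul_eq_mul, mul_one, card_nearest hKn,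
    ENNReal.inv_mul_cancel hK0 (ENNReal.natCast_ne_top K), Finset.card_univ, Fintype.card_fin,
    ENNReal.inv_mul_cancel hn0 (ENNReal.natCast_ne_top n)]

lemma isProbabilityMeasure_bind_smoteSample (hK : 1 ≤ K) (hKn : K < n)
    (P : Measure (Dataset n d)) [IsProbabilityMeasure P] :
    IsProbabilityMeasure (P.bind (smoteSample K)) := by
  have huniv (x : Dataset n d) : smoteSample K x Set.univ = 1 :=
    (isProbabilityMeasure_smoteSample hK hKn x).measure_univ
  refine ⟨?_⟩
  rw [Measure.bind_apply MeasurableSet.univ (measurable_smoteSample K).aemeasurable]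
  simp [huniv]

lemma recordLaw_eq_of_map_eval (hm : 1 ≤ m) {P : Measure (Dataset m d)} {ν : Measure (Record d)}
    (h : ∀ r, P.map (fun x => x r) = ν) : recordLaw P = ν := by
  have hm0 : (m : ℝ≥0∞) ≠ 0 := by exact_mod_cast (by omega : m ≠ 0)
  ext s
  simp only [recordLaw, h, Finset.sum_const, Finset.card_univ, Fintype.card_fin, Measure.smul_apply,
    smul_eq_mul, nsmul_eq_mul, ENNReal.inv_mul_cancel_left hm0 (ENNReal.natCast_ne_top m)]

lemma recordLaw_gaussianData (hn : 1 ≤ n) (θ : Record d × Matrix (Fin d) (Fin d) ℝ) :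
    recordLaw (gaussianData n θ) = multivariateGaussian θ.1 θ.2 :=
  recordLaw_eq_of_map_eval hn fun r =>
    (measurePreserving_eval (fun _ => multivariateGaussian θ.1 θ.2) r).map_eq

lemma recordLaw_bind_smote (hK : 1 ≤ K) (hKn : K < n) (hm : 1 ≤ m) (P : Measure (Dataset n d)) :
    recordLaw (P.bind (smote n m d K)) = P.bind (smoteSample K) := by
  refine recordLaw_eq_of_map_eval hm fun r => ?_
  ext s hs
  have hs' : MeasurableSet ((fun x : Dataset m d => x r) ⁻¹' s) := measurable_pi_apply r hs
  rw [Measure.map_apply (measurable_pi_apply r) hs, Measure.bind_apply hs'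
    (smote n m d K).measurable.aemeasurable, Measure.bind_apply hs
    (measurable_smoteSample K).aemeasurable]
  refine lintegral_congr fun x => ?_
  have := isProbabilityMeasure_smoteSample hK hKn x
  exact (measurePreserving_eval (fun _ : Fin m => smoteSample K x) r).measure_preimage
    hs.nullMeasurableSet

end RecordLaw

section GaussianSmote

variable {n d K : ℕ} {S : Matrix (Fin d) (Fin d) ℝ}

instance (n : ℕ) (θ : Record d × Matrix (Fin d) (Fin d) ℝ) :
    IsProbabilityMeasure (gaussianData n θ) := by
  unfold gaussianData
  infer_instance

lemma lintegral_bind_smoteSample_norm_sub_sq_lt (hK : 1 ≤ K) (hKn : K < n) (μ : Record d)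
    (hS : S.PosSemidef) (hS0 : S ≠ 0) :
    ∫⁻ z, ENNReal.ofReal (‖z - μ‖ ^ 2) ∂(gaussianData n (μ, S)).bind (smoteSample K) <
      ENNReal.ofReal S.trace := by
  set Q := neighbourPairLaw K (gaussianData n (μ, S))
  have hfst {f : Record d → ℝ≥0∞} (hf : Measurable f) :
      ∫⁻ p, f p.1 ∂Q = ∫⁻ z, f z ∂multivariateGaussian μ S := by
    rw [lintegral_neighbourPairLaw_fst hK hKn _ hf, recordLaw_gaussianData (by omega)]
  have : IsProbabilityMeasure Q := ⟨by simpa using hfst (f := fun _ => 1) measurable_const⟩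
  have hbase : ∫⁻ p, ENNReal.ofReal (‖p.1 - μ‖ ^ 2) ∂Q = ENNReal.ofReal S.trace := by
    rw [hfst (f := fun z => ENNReal.ofReal (‖z - μ‖ ^ 2)) (by fun_prop),
      lintegral_norm_sub_sq_multivariateGaussian μ hS]
  have hle : ∫⁻ p, ENNReal.ofReal (‖p.2 - μ‖ ^ 2) ∂Q ≤ ∫⁻ p, ENNReal.ofReal (‖p.1 - μ‖ ^ 2) ∂Q := by
    rw [lintegral_neighbourPairLaw _ (by fun_prop), lintegral_neighbourPairLaw _ (by fun_prop)]
    exact mul_le_mul_right (Finset.sum_le_sum fun i _ => mul_le_mul_right (Finset.sum_le_sum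
      fun j _ => setLIntegral_mem_nearest_norm_sq_le K μ hS i j) _) _
  have hdiag : Q {p | p.1 = p.2} = 0 := by
    have := nullSingletonClass_multivariateGaussian μ hS hS0
    exact neighbourPairLaw_diagonal fun i j hij => measure_pi_eval_eq_eval _ hij
  rw [lintegral_bind_smoteSample hKn _ (by fun_prop), ← hbase]
  exact lintegral_segmentLaw_norm_sub_sq_lt hdiag hle (hbase ▸ ENNReal.ofReal_ne_top)

lemma smoteSample_map {d' : ℕ} (f : Record d →ᵃⁱ[ℝ] Record d') (x : Dataset n d) :
    smoteSample K (fun k => f (x k)) = (smoteSample K x).map f := by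
  have hf : Measurable f := f.continuous.measurable
  ext s hs
  rw [Measure.map_apply hf hs]
  simp only [smoteSample, nearest_map_isometry f.isometry, segmentLaw_map, Measure.smul_apply,
    Measure.coe_finsetSum, Finset.sum_apply, Measure.map_apply hf hs]

lemma bind_smoteSample_map {d' : ℕ} (f : Record d →ᵃⁱ[ℝ] Record d') (P : Measure (Dataset n d)) :
    (P.map fun x k => f (x k)).bind (smoteSample K) = (P.bind (smoteSample K)).map f := by
  have hf : Measurable f := f.continuous.measurable
  ext s hs
  have hprob : Measurable fun x : Dataset n d' => smoteSample K x s :=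
    (Measure.measurable_coe hs).comp (measurable_smoteSample K)
  rw [Measure.map_apply hf hs,
    Measure.bind_apply hs (measurable_smoteSample K).aemeasurable,
    Measure.bind_apply (hf hs) (measurable_smoteSample K).aemeasurable,
    lintegral_map hprob (by fun_prop)]
  simp only [smoteSample_map, Measure.map_apply hf hs]

lemma gaussianData_map_pointReflection (μ : Record d) (S : Matrix (Fin d) (Fin d) ℝ) :
    (gaussianData n (μ, S)).map (fun x k => AffineIsometryEquiv.pointReflection ℝ μ (x k)) =
      gaussianData n (μ, S) :=
  (measurePreserving_pi _ _ fun _ =>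
    ⟨(AffineIsometryEquiv.continuous _).measurable,
      multivariateGaussian_map_pointReflection μ S⟩).map_eq

lemma integral_id_bind_smoteSample (hK : 1 ≤ K) (hKn : K < n) (μ : Record d)
    (hS : S.PosSemidef) (hS0 : S ≠ 0) :
    ∫ z, z ∂(gaussianData n (μ, S)).bind (smoteSample K) = μ := by
  have := isProbabilityMeasure_bind_smoteSample hK hKn (gaussianData n (μ, S))
  refine integral_id_eq_of_map_pointReflection (integrable_id_of_lintegral_norm_sub_sq_ne_top
    (lintegral_bind_smoteSample_norm_sub_sq_lt hK hKn μ hS hS0).ne_top) ?_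
  have hmap := bind_smoteSample_map (K := K)
    (AffineIsometryEquiv.pointReflection ℝ μ).toAffineIsometry (gaussianData n (μ, S))
  simp only [AffineIsometryEquiv.coe_toAffineIsometry, gaussianData_map_pointReflection] at hmap
  exact hmap.symm

end GaussianSmote

section Sensitivity

variable {n m d K : ℕ}

lemma trace_dataCov (P : Measure (Dataset m d)) :
    (dataCov P).trace = ∑ a, Var[fun z : Record d => z a; recordLaw P] :=
  Finset.sum_congr rfl fun _ _ => covariance_self (by fun_prop)

lemma dataMean_gaussianData (hn : 1 ≤ n) (θ : Record d × Matrix (Fin d) (Fin d) ℝ) :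
    dataMean (gaussianData n θ) = θ.1 := by
  rw [dataMean, recordLaw_gaussianData hn, integral_id_multivariateGaussian]

lemma trace_dataCov_gaussianData (hn : 1 ≤ n) {θ : Record d × Matrix (Fin d) (Fin d) ℝ}
    (hθ : θ.2.PosSemidef) : (dataCov (gaussianData n θ)).trace = θ.2.trace := by
  rw [trace_dataCov, recordLaw_gaussianData hn]
  simp_rw [variance_eval_multivariateGaussian hθ]
  rfl

lemma dataMean_smote (hK : 1 ≤ K) (hKn : K < n) (hm : 1 ≤ m)
    {θ : Record d × Matrix (Fin d) (Fin d) ℝ} (hθ : θ.2.PosSemidef) (hθ0 : θ.2 ≠ 0) :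
    dataMean ((gaussianData n θ).bind (smote n m d K)) = θ.1 := by
  rw [dataMean, recordLaw_bind_smote hK hKn hm]
  exact integral_id_bind_smoteSample hK hKn θ.1 hθ hθ0

lemma trace_dataCov_smote_lt (hK : 1 ≤ K) (hKn : K < n) (hm : 1 ≤ m)
    {θ : Record d × Matrix (Fin d) (Fin d) ℝ} (hθ : θ.2.PosSemidef) (hθ0 : θ.2 ≠ 0) :
    (dataCov ((gaussianData n θ).bind (smote n m d K))).trace < θ.2.trace := by
  have hlt := lintegral_bind_smoteSample_norm_sub_sq_lt hK hKn θ.1 hθ hθ0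
  have := isProbabilityMeasure_bind_smoteSample hK hKn (gaussianData n θ)
  rw [← ofReal_sum_variance_eval hlt.ne_top
    (integral_id_bind_smoteSample hK hKn θ.1 hθ hθ0)] at hlt
  rw [trace_dataCov, recordLaw_bind_smote hK hKn hm]
  exact (ENNReal.ofReal_lt_ofReal_iff_of_nonneg
    (Finset.sum_nonneg fun a _ => variance_nonneg _ _)).1 hlt

/-- The quantity maximised in the sensitivity of the generative model `f`, for a pair of datasets
with laws `N(θ)` and `N(θ')`; it depends on their joint law only through these marginals. -/
noncomputable def sensitivityValue (f : Kernel (Dataset n d) (Dataset m d))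
    (θ θ' : Record d × Matrix (Fin d) (Fin d) ℝ) : ℝ :=
  ‖dataMean ((gaussianData n θ).bind f) - dataMean ((gaussianData n θ').bind f)‖ +
    (dataCov ((gaussianData n θ).bind f) + dataCov ((gaussianData n θ').bind f)).trace

lemma mem_sensitivityValues_iff {Θ : Set (Record d × Matrix (Fin d) (Fin d) ℝ)}
    {f : Kernel (Dataset n d) (Dataset m d)} {v : ℝ} :
    v ∈ sensitivityValues Θ f ↔ ∃ θ ∈ Θ, ∃ θ' ∈ Θ,
      (∃ π : Measure (Dataset n d × Dataset n d), IsNeighbouring θ θ' π) ∧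
      v = sensitivityValue f θ θ' := by
  constructor
  · rintro ⟨θ, hθ, θ', hθ', π, hπ, rfl⟩
    exact ⟨θ, hθ, θ', hθ', ⟨π, hπ⟩, by rw [hπ.1, hπ.2.1, sensitivityValue]⟩
  · rintro ⟨θ, hθ, θ', hθ', ⟨π, hπ⟩, rfl⟩
    exact ⟨θ, hθ, θ', hθ', π, hπ, by rw [hπ.1, hπ.2.1, sensitivityValue]⟩

lemma exists_isNeighbouring_self (θ : Record d × Matrix (Fin d) (Fin d) ℝ) :
    ∃ π : Measure (Dataset n d × Dataset n d), IsNeighbouring θ θ π := by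
  have hdiag : Measurable fun x : Dataset n d => (x, x) := by fun_prop
  refine ⟨(gaussianData n θ).map fun x => (x, x), ?_, ?_, ?_⟩
  · rw [Measure.fst, Measure.map_map measurable_fst hdiag]
    exact Measure.map_id
  · rw [Measure.snd, Measure.map_map measurable_snd hdiag]
    exact Measure.map_id
  · have heq : ∀ᵐ p ∂(gaussianData n θ).map fun x => (x, x), p.1 = p.2 :=
      (ae_map_iff hdiag.aemeasurable (measurableSet_eq_fun measurable_fst measurable_snd)).2
        (Filter.Eventually.of_forall fun _ => rfl)
    filter_upwards [heq] with p hp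
    simp [hp]

lemma exists_isSensitivity {Θ : Set (Record d × Matrix (Fin d) (Fin d) ℝ)} (hfin : Θ.Finite)
    (hne : Θ.Nonempty) (f : Kernel (Dataset n d) (Dataset m d)) :
    ∃ Δ : ℝ, IsSensitivity Θ f Δ := by
  have hfinite : (sensitivityValues Θ f).Finite := by
    refine (hfin.image2 (sensitivityValue f) hfin).subset fun v hv => ?_
    obtain ⟨θ, hθ, θ', hθ', _, rfl⟩ := mem_sensitivityValues_iff.1 hv
    exact Set.mem_image2_of_mem hθ hθ'
  obtain ⟨θ, hθ⟩ := hne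
  have hnonempty : (sensitivityValues Θ f).Nonempty :=
    ⟨_, mem_sensitivityValues_iff.2 ⟨θ, hθ, θ, hθ, exists_isNeighbouring_self θ, rfl⟩⟩
  exact ⟨_, hnonempty.csSup_mem hfinite, fun _ hv => le_csSup hfinite.bddAbove hv⟩

lemma sensitivityValue_smote_lt (hK : 1 ≤ K) (hKn : K < n) (hm : 1 ≤ m)
    {θ θ' : Record d × Matrix (Fin d) (Fin d) ℝ} (hθ : θ.2.PosSemidef ∧ θ.2 ≠ 0)
    (hθ' : θ'.2.PosSemidef ∧ θ'.2 ≠ 0) :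
    sensitivityValue (smote n m d K) θ θ' <
      sensitivityValue (Kernel.id : Kernel (Dataset n d) _) θ θ' := by
  have hn : 1 ≤ n := by omega
  have hid (θ) : (gaussianData n θ).bind (Kernel.id : Kernel (Dataset n d) _) =
      gaussianData n θ := Measure.bind_dirac
  rw [sensitivityValue, sensitivityValue, hid, hid, dataMean_smote hK hKn hm hθ.1 hθ.2,
    dataMean_smote hK hKn hm hθ'.1 hθ'.2, dataMean_gaussianData hn, dataMean_gaussianData hn,
    Matrix.trace_add, Matrix.trace_add, trace_dataCov_gaussianData hn hθ.1,
    trace_dataCov_gaussianData hn hθ'.1]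
  gcongr
  · exact trace_dataCov_smote_lt hK hKn hm hθ.1 hθ.2
  · exact trace_dataCov_smote_lt hK hKn hm hθ'.1 hθ'.2

end Sensitivity

end SmoteDP

theorem theorem1 {n m d K : ℕ} (hK : 1 ≤ K) (hKn : K < n) (hm : 1 ≤ m)
    (Θ : Set (SmoteDP.Record d × Matrix (Fin d) (Fin d) ℝ))
    (hΘ : ∀ θ ∈ Θ, θ.2.PosSemidef ∧ θ.2 ≠ 0) :
    (∀ Δf Δfs : ℝ, SmoteDP.IsSensitivity Θ (Kernel.id : Kernel (SmoteDP.Dataset n d) _) Δf →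
      SmoteDP.IsSensitivity Θ (SmoteDP.smote n m d K) Δfs → Δfs < Δf) ∧
    (Θ.Finite → Θ.Nonempty →
      (∃ Δf : ℝ, SmoteDP.IsSensitivity Θ (Kernel.id : Kernel (SmoteDP.Dataset n d) _) Δf) ∧
      ∃ Δfs : ℝ, SmoteDP.IsSensitivity Θ (SmoteDP.smote n m d K) Δfs) := by
  refine ⟨fun Δf Δfs hf hfs => ?_, fun hfin hne =>
    ⟨SmoteDP.exists_isSensitivity hfin hne _, SmoteDP.exists_isSensitivity hfin hne _⟩⟩
  obtain ⟨θ, hθ, θ', hθ', hπ, rfl⟩ := SmoteDP.mem_sensitivityValues_iff.1 hfs.1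
  exact (SmoteDP.sensitivityValue_smote_lt hK hKn hm (hΘ θ hθ) (hΘ θ' hθ')).trans_le
    (hf.2 (SmoteDP.mem_sensitivityValues_iff.2 ⟨θ, hθ, θ', hθ', hπ, rfl⟩))
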